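/- For integers $0\le k\le n$, let the slice $\binom{[n]}{k}$ be the set of all $x\in\{0,1\}^n$ with $\sum_{i=1}^n x_i=k$. Let $f\colon\binom{[n]}{k}\to\mathbb{R}$. The function $f$ is Boolean if $f(x)\in\{0,1\}$ for all $x\in\binom{[n]}{k}$. It has degree (at most) $d$ if there is a real polynomial $P$ in $n$ variables of total degree at most $d$ such that $f(x)=P(x_1,\ldots,x_n)$ for all $x\in\binom{[n]}{k}$. It is an $m$-junta if there are a set $J\subseteq[n]$ with $|J|\le m$ and a function $g\colon\{0,1\}^J\to\mathbb{R}$ such that $f(x)=g(x|_J)$ for all $x\in\binom{[n]}{k}$. Theorem 1.1. Let $d\ge 1$ be an integer. There exists a constant $m(d)$, depending only on $d$, such that for all integers $k\ge 2d$ and $n\ge 2k$, every Boolean degree-$d$ function on $\binom{[n]}{k}$ is an $m(d)$-junta. Conversely, for every integer $k$ with $1\le k<2d$ and every integer $m\ge 0$, there exist an integer $n\ge 2k$ and a Boolean degree-$d$ function on $\binom{[n]}{k}$ that is not an $m$-junta. -/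

import Mathlib

namespace BooleanSlice

/-- The slice `([n] choose k)`: all vectors in `{0,1}^n` with exactly `k` coordinates
equal to `1`. Bits are modelled by `Bool`, with `true` for `1`. -/
abbrev Slice (n k : ℕ) : Type :=
  {x : Fin n → Bool // ∑ i, (x i).toNat = k}

/-- A real-valued function on the slice is `A`-valued if all its values lie in `A`. -/
def IsValuedIn {n k : ℕ} (A : Set ℝ) (f : Slice n k → ℝ) : Prop :=
  ∀ x, f x ∈ A

/-- A Boolean function is a `{0,1}`-valued function. -/
def IsBoolean {n k : ℕ} (f : Slice n k → ℝ) : Prop :=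
  IsValuedIn {0, 1} f

/-- `f` has degree (at most) `d`: it agrees on the slice with a real polynomial of total degree
at most `d` in the coordinates `x_1, …, x_n`. -/
def HasDegree {n k : ℕ} (d : ℕ) (f : Slice n k → ℝ) : Prop :=
  ∃ P : MvPolynomial (Fin n) ℝ, P.totalDegree ≤ d ∧
    ∀ x : Slice n k, f x = MvPolynomial.eval (fun i => ((x.1 i).toNat : ℝ)) P

/-- `f` is a `J`-junta: `f x` is a function of the restriction of `x` to the coordinates in `J`. -/
def IsJuntaOn {n k : ℕ} (J : Finset (Fin n)) (f : Slice n k → ℝ) : Prop :=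
  ∃ g : (J → Bool) → ℝ, ∀ x : Slice n k, f x = g (fun i => x.1 i)

/-- `f` is an `m`-junta: it is a `J`-junta for some set `J` of at most `m` coordinates. -/
def IsJunta {n k : ℕ} (m : ℕ) (f : Slice n k → ℝ) : Prop :=
  ∃ J : Finset (Fin n), J.card ≤ m ∧ IsJuntaOn J f

end BooleanSlice

/-! Upper bound, `k` large (`exists_dependsOnlyOn_of_large`): induct on the degree, for functions
with boundedly many values rather than just two. If `f` is not a junta, there are many disjoint
pairs `{i, j}` whose exchange changes `f` somewhere. Each difference `f (x ∪ {i}) - f (x ∪ {j})` has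
smaller degree and boundedly many values, so by induction it is a fixed nonzero number as soon as
boundedly many coordinates are suitably fixed. Many of these partial assignments are compatible
(`exists_compatible`). Imposing them all makes `f` a constant plus arbitrary subset sums of nonzero
reals, which is too many values (`card_lt_card_of_compatible`).

The finitely many remaining `k ≥ 2 * d` are treated one at a time (`exists_dependsOnlyOn_of_fixed`).
Let `W` hold the coordinates of a few disjoint sensitive swaps. Ramsey's theorem finds `Z` outside
`W` such that completing `T ⊆ W` to weight `k` inside `Z` gives a value `F T` independent of the
completion. Then `F` has degree at most `d` on the ball of radius `k` in `W`
(`exists_degreeLT_of_completion`). Since `F ^ 2 - F` has degree at most `2 * d ≤ k`, the polynomial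
is Boolean on the whole cube (`boolean_of_boolean_ball`), hence a junta by the first case, yet each
disjoint swap needs its own relevant coordinate. This is where the threshold `2 * d` enters.

Lower bound: sum the products of coordinates over many disjoint blocks of size `min d k`. Weight
below `2 * d` leaves no room for two full blocks. -/

namespace BooleanSlice

open Finset

/-! ### Multilinear polynomials on finite sets -/

/-- The value at the indicator vector of `x` of the multilinear polynomial with
coefficients `c`. -/
def multilinearEval (c : Finset ℕ → ℝ) (x : Finset ℕ) : ℝ := ∑ S ∈ x.powerset, c S

/-- The coefficients `c` vanish in all degrees at least `e`. -/
def DegreeLT (e : ℕ) (c : Finset ℕ → ℝ) : Prop := ∀ S : Finset ℕ, e ≤ S.card → c S = 0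

/-- `f` restricted to the `k`-subsets of `V` depends only on the intersection with `J`. -/
def DependsOnlyOn (V : Finset ℕ) (k : ℕ) (J : Finset ℕ) (f : Finset ℕ → ℝ) : Prop :=
  ∀ x ∈ V.powersetCard k, ∀ y ∈ V.powersetCard k, x ∩ J = y ∩ J → f x = f y

/-- The coefficients of the polynomial `x ↦ f (x ∪ {i}) - f (x ∪ {j})`, for `f` of degree at most
`e` with coefficients `c`. -/
def swapCoeff (e : ℕ) (c : Finset ℕ → ℝ) (i j : ℕ) (S : Finset ℕ) : ℝ :=
  if e ≤ S.card then 0 else c (insert i S) - c (insert j S)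

/-- The cut-off in `swapCoeff` is needed for sets containing `i` or `j`, where the difference of
coefficients may be nonzero in degree `e`. -/
theorem degreeLT_swapCoeff (e : ℕ) (c : Finset ℕ → ℝ) (i j : ℕ) :
    DegreeLT e (swapCoeff e c i j) := fun S hS => by simp [swapCoeff, hS]

theorem multilinearEval_insert (c : Finset ℕ → ℝ) {i : ℕ} {x : Finset ℕ} (hi : i ∉ x) :
    multilinearEval c (insert i x) =
      multilinearEval c x + multilinearEval (fun S => c (insert i S)) x :=
  sum_powerset_insert hi c

theorem multilinearEval_sub_multilinearEval {e : ℕ} {c : Finset ℕ → ℝ} (hc : DegreeLT (e + 1) c)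
    {i j : ℕ} {x : Finset ℕ} (hi : i ∉ x) (hj : j ∉ x) :
    multilinearEval c (insert i x) - multilinearEval c (insert j x) =
      multilinearEval (swapCoeff e c i j) x := by
  rw [multilinearEval_insert c hi, multilinearEval_insert c hj, add_sub_add_left_eq_sub]
  simp only [multilinearEval, ← sum_sub_distrib]
  refine sum_congr rfl fun S hS => ?_
  rw [mem_powerset] at hS
  unfold swapCoeff
  split_ifs with h
  · rw [hc _ (by rw [card_insert_of_notMem (fun h => hi (hS h))]; omega),
      hc _ (by rw [card_insert_of_notMem (fun h => hj (hS h))]; omega), sub_zero]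
  · rfl

/-! ### Sensitive swaps -/

/-- `g = (i, j, z)` witnesses that exchanging the coordinates `i` and `j` changes the value of `f`
at some point of the slice. -/
structure IsSensitiveSwap (V : Finset ℕ) (k : ℕ) (f : Finset ℕ → ℝ)
    (g : ℕ × ℕ × Finset ℕ) : Prop where
  fst_mem : g.1 ∈ V
  snd_mem : g.2.1 ∈ V
  subset : g.2.2 ⊆ V
  fst_notMem : g.1 ∉ g.2.2
  snd_notMem : g.2.1 ∉ g.2.2
  card : g.2.2.card + 1 = k
  ne : f (insert g.1 g.2.2) ≠ f (insert g.2.1 g.2.2)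

/-- The two coordinates which are exchanged. -/
def swapPair (g : ℕ × ℕ × Finset ℕ) : Finset ℕ := {g.1, g.2.1}

theorem card_swapPair_le (g : ℕ × ℕ × Finset ℕ) : (swapPair g).card ≤ 2 := card_le_two

/-- Two points of the slice that agree on `J` are joined by a path of swaps outside `J`, so some
swap along a path must change `f`. -/
theorem exists_isSensitiveSwap {V : Finset ℕ} {k : ℕ} {J : Finset ℕ} {f : Finset ℕ → ℝ}
    (h : ¬ DependsOnlyOn V k J f) :
    ∃ g, IsSensitiveSwap V k f g ∧ Disjoint (swapPair g) J := by
  by_contra! hno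
  apply h
  suffices H : ∀ t : ℕ, ∀ x ∈ V.powersetCard k, ∀ y ∈ V.powersetCard k, (x \ y).card = t →
      x ∩ J = y ∩ J → f x = f y from fun x hx y hy => H _ x hx y hy rfl
  intro t
  induction t with
  | zero =>
    intro x hx y hy h0 _
    rw [mem_powersetCard] at hx hy
    rw [card_eq_zero, sdiff_eq_empty_iff_subset] at h0
    rw [eq_of_subset_of_card_le h0 (by omega)]
  | succ t ih =>
    intro x hx y hy ht hJ
    rw [mem_powersetCard] at hx hy
    have ht' : (y \ x).card = t + 1 := by
      rw [← ht, card_sdiff_comm (by omega)]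
    obtain ⟨i, hi⟩ : (x \ y).Nonempty := card_pos.1 (by omega)
    obtain ⟨j, hj⟩ : (y \ x).Nonempty := card_pos.1 (by omega)
    rw [mem_sdiff] at hi hj
    have hmem : ∀ u, u ∈ x ∧ u ∈ J ↔ u ∈ y ∧ u ∈ J := fun u => by
      rw [← mem_inter, ← mem_inter, hJ]
    have hiJ : i ∉ J := fun h => hi.2 ((hmem i).1 ⟨hi.1, h⟩).1
    have hjJ : j ∉ J := fun h => hj.2 ((hmem j).2 ⟨hj.1, h⟩).1
    have hjx : j ∉ x.erase i := fun h => hj.2 (mem_of_mem_erase h)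
    have hcard : (x.erase i).card + 1 = k := by rw [card_erase_add_one hi.1, hx.2]
    have h1 : f x = f (insert j (x.erase i)) := by
      by_contra hne
      refine hno (i, j, x.erase i) ⟨hx.1 hi.1, hy.1 hj.1, (erase_subset _ _).trans hx.1,
        notMem_erase _ _, hjx, hcard, ?_⟩ ?_
      · simpa [insert_erase hi.1] using hne
      · simp [swapPair, hiJ, hjJ]
    rw [h1]
    refine ih _ ?_ y (mem_powersetCard.2 hy) ?_ ?_
    · rw [mem_powersetCard, card_insert_of_notMem hjx]
      exact ⟨insert_subset (hy.1 hj.1) ((erase_subset _ _).trans hx.1), hcard⟩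
    · have : insert j (x.erase i) \ y = (x \ y).erase i := by
        ext u; simp only [mem_sdiff, mem_insert, mem_erase]
        constructor
        · rintro ⟨rfl | h, h'⟩
          · exact absurd hj.1 h'
          · exact ⟨h.1, h.2, h'⟩
        · rintro ⟨h, h', h''⟩
          exact ⟨Or.inr ⟨h, h'⟩, h''⟩
      rw [this, card_erase_of_mem (mem_sdiff.2 hi), ht]; rfl
    · rw [← hJ]
      ext u; simp only [mem_inter, mem_insert, mem_erase]
      constructor
      · rintro ⟨rfl | h, h'⟩
        · exact absurd h' hjJ
        · exact ⟨h.2, h'⟩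
      · rintro ⟨h, h'⟩
        exact ⟨Or.inr ⟨fun h => hiJ (h ▸ h'), h⟩, h'⟩

/-- Greedy choice: the pairs chosen so far cover at most `2 * r` coordinates, so another sensitive
swap avoids them. -/
theorem exists_pairwiseDisjoint_isSensitiveSwap {V : Finset ℕ} {k : ℕ} {f : Finset ℕ → ℝ} {r : ℕ}
    (h : ∀ J : Finset ℕ, J.card ≤ 2 * r → ¬ DependsOnlyOn V k J f) :
    ∃ G : Finset (ℕ × ℕ × Finset ℕ), G.card = r ∧ (∀ g ∈ G, IsSensitiveSwap V k f g) ∧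
      ∀ g ∈ G, ∀ g' ∈ G, g ≠ g' → Disjoint (swapPair g) (swapPair g') := by
  suffices H : ∀ t ≤ r, ∃ G : Finset (ℕ × ℕ × Finset ℕ), G.card = t ∧
      (∀ g ∈ G, IsSensitiveSwap V k f g) ∧
      ∀ g ∈ G, ∀ g' ∈ G, g ≠ g' → Disjoint (swapPair g) (swapPair g') from H r le_rfl
  intro t
  induction t with
  | zero => exact fun _ => ⟨∅, by simp⟩
  | succ t ih =>
    intro ht
    obtain ⟨G, hG, hs, hd⟩ := ih (by omega)
    have hcard : (G.biUnion swapPair).card ≤ 2 * r :=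
      (card_biUnion_le_card_mul G swapPair 2 fun g _ => card_swapPair_le g).trans (by omega)
    obtain ⟨g, hg, hgd⟩ := exists_isSensitiveSwap (h _ hcard)
    rw [disjoint_biUnion_right] at hgd
    have hgG : g ∉ G := fun hmem => by
      have := hgd g hmem
      rw [disjoint_self_iff_empty] at this
      simp [swapPair] at this
    refine ⟨insert g G, by rw [card_insert_of_notMem hgG, hG], ?_, ?_⟩
    · intro g' hg'
      rcases mem_insert.1 hg' with rfl | hg'
      exacts [hg, hs _ hg']
    · intro a ha b hb hab
      rcases mem_insert.1 ha with rfl | ha' <;> rcases mem_insert.1 hb with rfl | hb'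
      exacts [absurd rfl hab, hgd _ hb', (hgd _ ha').symm, hd _ ha' _ hb' hab]

/-! ### Compatible partial assignments -/

/-- Among many partial assignments of bounded size (`A g` is set to one, `B g` to zero, and the
pairwise disjoint sets `p g` are left free) there are `r` pairwise compatible ones. -/
theorem exists_compatible (t r : ℕ) :
    ∃ M : ℕ, ∀ {γ : Type} [DecidableEq γ] (G : Finset γ) (p A B : γ → Finset ℕ),
      M ≤ G.card →
      (∀ g ∈ G, (p g).card ≤ 2) →
      (∀ g ∈ G, ∀ g' ∈ G, g ≠ g' → Disjoint (p g) (p g')) →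
      (∀ g ∈ G, (A g).card + (B g).card ≤ t) →
      (∀ g ∈ G, Disjoint (A g) (B g) ∧ Disjoint (p g) (A g) ∧ Disjoint (p g) (B g)) →
      ∃ L ⊆ G, L.card = r ∧ ∀ g ∈ L, ∀ g' ∈ L,
        Disjoint (A g) (B g') ∧ Disjoint (p g) (A g') ∧ Disjoint (p g) (B g') := by
  induction t generalizing r with
  | zero =>
    refine ⟨r, fun {γ} _ G p A B hM _ _ ht _ => ?_⟩
    obtain ⟨L, hLG, hL⟩ := exists_subset_card_eq hM
    refine ⟨L, hLG, hL, fun g hg g' hg' => ?_⟩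
    have h1 := ht g (hLG hg)
    have h2 := ht g' (hLG hg')
    rw [card_eq_zero.1 (by omega : (A g).card = 0), card_eq_zero.1 (by omega : (A g').card = 0),
      card_eq_zero.1 (by omega : (B g').card = 0)]
    simp
  | succ t iht =>
    induction r with
    | zero => exact ⟨0, fun {γ} _ G p A B _ _ _ _ _ => ⟨∅, by simp⟩⟩
    | succ r ihr =>
      obtain ⟨M₁, hM₁⟩ := ihr
      obtain ⟨M₂, hM₂⟩ := iht (r + 1)
      -- `t + 3` bounds the support of `g₀`, free pair included. If fewer than `M₁` others avoid it,
      -- some coordinate `u` of it lies in more than `2 * M₂ + 1` other supports; `u` is free in at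
      -- most one of them, so at least `M₂` give `u` the same value.
      refine ⟨M₁ + (t + 3) * (2 * M₂ + 2) + 1, fun {γ} _ G p A B hM hp hpp ht hd => ?_⟩
      obtain ⟨g₀, hg₀⟩ : G.Nonempty := card_pos.1 (by omega)
      set s : γ → Finset ℕ := fun g => p g ∪ (A g ∪ B g) with hs
      have hs0 : (s g₀).card ≤ t + 3 := by
        have h1 := card_union_le (p g₀) (A g₀ ∪ B g₀)
        have h2 := card_union_le (A g₀) (B g₀)
        have h3 := hp g₀ hg₀
        have h4 := ht g₀ hg₀
        simp only [hs]; omega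
      set G₁ := (G.erase g₀).filter fun g => Disjoint (s g₀) (s g) with hG₁
      set G₂ := (G.erase g₀).filter fun g => ¬ Disjoint (s g₀) (s g) with hG₂
      have hsum : G₁.card + G₂.card = G.card - 1 := by
        rw [hG₁, hG₂, card_filter_add_card_filter_not, card_erase_of_mem hg₀]
      have hG₁G : G₁ ⊆ G := (filter_subset _ _).trans (erase_subset _ _)
      have hG₂G : G₂ ⊆ G := (filter_subset _ _).trans (erase_subset _ _)
      by_cases hlarge : M₁ ≤ G₁.card
      · obtain ⟨L, hL, hLr, hLd⟩ := hM₁ G₁ p A B hlarge (fun g hg => hp g (hG₁G hg))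
          (fun g hg g' hg' => hpp g (hG₁G hg) g' (hG₁G hg')) (fun g hg => ht g (hG₁G hg))
          (fun g hg => hd g (hG₁G hg))
        have hdis : ∀ g ∈ L, Disjoint (s g₀) (s g) := fun g hg => (mem_filter.1 (hL hg)).2
        have hg₀L : g₀ ∉ L := fun h => by simpa [hG₁] using hL h
        refine ⟨insert g₀ L, insert_subset hg₀ (hL.trans hG₁G),
          by rw [card_insert_of_notMem hg₀L, hLr], fun g hg g' hg' => ?_⟩
        rcases mem_insert.1 hg with h | h <;> rcases mem_insert.1 hg' with h' | h'
        · rw [h, h']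
          exact hd g₀ hg₀
        · have := hdis g' h'
          rw [h]
          simp only [hs, disjoint_union_left, disjoint_union_right] at this
          tauto
        · have := (hdis g h).symm
          rw [h']
          simp only [hs, disjoint_union_left, disjoint_union_right] at this
          tauto
        · exact hLd g h g' h'
      · have hv : ∀ g ∈ G₂, ∃ v, v ∈ s g₀ ∧ v ∈ s g := fun g hg =>
          not_disjoint_iff.1 (mem_filter.1 hg).2
        choose! v hv₀ hv using hv
        have hlt : (s g₀).card * (2 * M₂ + 1) < G₂.card := by
          have : (s g₀).card * (2 * M₂ + 1) ≤ (t + 3) * (2 * M₂ + 1) := Nat.mul_le_mul_right _ hs0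
          have h2 : (t + 3) * (2 * M₂ + 2) = (t + 3) * (2 * M₂ + 1) + (t + 3) := by ring
          omega
        obtain ⟨u, hu, huc⟩ := exists_lt_card_fiber_of_mul_lt_card_of_maps_to hv₀ hlt
        set H := G₂.filter fun g => v g = u with hH
        have hHG : H ⊆ G := (filter_subset _ _).trans hG₂G
        have huH : ∀ g ∈ H, u ∈ p g ∨ u ∈ A g ∨ u ∈ B g := fun g hg => by
          have h1 := mem_filter.1 hg
          have h2 := hv g h1.1
          rw [h1.2] at h2
          simpa [hs] using h2
        have hHp : (H.filter fun g => u ∈ p g).card ≤ 1 := card_le_one.2 fun a ha b hb => by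
          rw [mem_filter] at ha hb
          by_contra hab
          exact disjoint_left.1 (hpp a (hHG ha.1) b (hHG hb.1) hab) ha.2 hb.2
        have hcover : H ⊆ (H.filter fun g => u ∈ p g) ∪
            ((H.filter fun g => u ∈ A g) ∪ (H.filter fun g => u ∈ B g)) := fun g hg => by
          simp only [mem_union, mem_filter, hg, true_and]
          exact huH g hg
        have hc := (card_le_card hcover).trans ((card_union_le _ _).trans
          (Nat.add_le_add_left (card_union_le _ _) _))
        rcases le_or_gt M₂ (H.filter fun g => u ∈ A g).card with hA | hA
        · set H' := H.filter fun g => u ∈ A g with hH'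
          have hsub : H' ⊆ G := (filter_subset _ _).trans hHG
          have huA : ∀ g ∈ H', u ∈ A g := fun g hg => (mem_filter.1 hg).2
          obtain ⟨L, hL, hLr, hLd⟩ := hM₂ H' p (fun g => (A g).erase u) B hA
            (fun g hg => hp g (hsub hg))
            (fun g hg g' hg' => hpp g (hsub hg) g' (hsub hg'))
            (fun g hg => by
              have h1 := ht g (hsub hg)
              have h2 := card_erase_add_one (huA g hg)
              omega)
            (fun g hg => by
              obtain ⟨h1, h2, h3⟩ := hd g (hsub hg)
              exact ⟨h1.mono_left (erase_subset _ _), h2.mono_right (erase_subset _ _), h3⟩)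
          refine ⟨L, hL.trans hsub, hLr, fun g hg g' hg' => ?_⟩
          obtain ⟨h1, h2, h3⟩ := hLd g hg g' hg'
          -- As `u` is set to one by every member of `L`, no member sets it to zero or leaves it
          -- free, so restoring `u` keeps compatibility.
          have k1 := disjoint_left.1 (hd g' (hsub (hL hg'))).1 (huA g' (hL hg'))
          have k2 := disjoint_right.1 (hd g (hsub (hL hg))).2.1 (huA g (hL hg))
          refine ⟨?_, ?_, h3⟩
          · rw [← insert_erase (huA g (hL hg)), disjoint_insert_left]
            exact ⟨k1, h1⟩
          · rw [← insert_erase (huA g' (hL hg')), disjoint_insert_right]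
            exact ⟨k2, h2⟩
        · set H' := H.filter fun g => u ∈ B g with hH'
          have hsub : H' ⊆ G := (filter_subset _ _).trans hHG
          have huB : ∀ g ∈ H', u ∈ B g := fun g hg => (mem_filter.1 hg).2
          obtain ⟨L, hL, hLr, hLd⟩ := hM₂ H' p A (fun g => (B g).erase u) (by omega)
            (fun g hg => hp g (hsub hg))
            (fun g hg g' hg' => hpp g (hsub hg) g' (hsub hg'))
            (fun g hg => by
              have h1 := ht g (hsub hg)
              have h2 := card_erase_add_one (huB g hg)
              omega)
            (fun g hg => by
              obtain ⟨h1, h2, h3⟩ := hd g (hsub hg)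
              exact ⟨h1.mono_right (erase_subset _ _), h2, h3.mono_right (erase_subset _ _)⟩)
          refine ⟨L, hL.trans hsub, hLr, fun g hg g' hg' => ?_⟩
          obtain ⟨h1, h2, h3⟩ := hLd g hg g' hg'
          have k1 := disjoint_right.1 (hd g (hsub (hL hg))).1 (huB g (hL hg))
          have k2 := disjoint_right.1 (hd g (hsub (hL hg))).2.2 (huB g (hL hg))
          refine ⟨?_, h2, ?_⟩
          · rw [← insert_erase (huB g' (hL hg')), disjoint_insert_right]
            exact ⟨k1, h1⟩
          · rw [← insert_erase (huB g' (hL hg')), disjoint_insert_right]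
            exact ⟨k2, h3⟩

/-- Nonzero reals have at least one more subset sum than there are of them. -/
theorem card_lt_card_image_subsetSum {γ : Type} [DecidableEq γ] (L : Finset γ) (δ : γ → ℝ)
    (hδ : ∀ g ∈ L, δ g ≠ 0) :
    L.card < (L.powerset.image fun I => ∑ g ∈ I, δ g).card := by
  induction L using Finset.induction_on with
  | empty => simp
  | insert a L ha ih =>
    have ih := ih fun g hg => hδ g (mem_insert_of_mem hg)
    set S := L.powerset.image fun I => ∑ g ∈ I, δ g with hS
    set S' := (insert a L).powerset.image fun I => ∑ g ∈ I, δ g with hS'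
    have hsub : S ⊆ S' := image_subset_image (powerset_mono.2 (subset_insert _ _))
    have hshift : S.image (δ a + ·) ⊆ S' := by
      intro v hv
      simp only [hS, mem_image, mem_powerset] at hv
      obtain ⟨_, ⟨I, hI, rfl⟩, rfl⟩ := hv
      refine mem_image.2 ⟨insert a I, mem_powerset.2 (insert_subset_insert _ hI), ?_⟩
      rw [sum_insert fun h => ha (hI h)]
    -- Otherwise `S` is invariant under translation by `δ a`; comparing sums of elements gives
    -- `S.card * δ a = 0`.
    have hne : S ≠ S' := by
      intro heq
      rw [← heq] at hshift
      have heq2 := eq_of_subset_of_card_le hshift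
        (by rw [card_image_of_injective _ (add_right_injective (δ a))])
      have hsum : ∑ v ∈ S.image (δ a + ·), v = S.card * δ a + ∑ v ∈ S, v := by
        rw [sum_image fun x _ y _ h => add_right_injective (δ a) h, sum_add_distrib, sum_const,
          nsmul_eq_mul]
      rw [heq2] at hsum
      have h0 : (S.card : ℝ) * δ a = 0 := by linarith
      rcases mul_eq_zero.1 h0 with h | h
      · have : S.card = 0 := by exact_mod_cast h
        omega
      · exact hδ a (mem_insert_self _ _) h
    have := card_lt_card (hsub.ssubset_of_ne hne)
    rw [card_insert_of_notMem ha]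
    omega

/-! ### Slices far from both ends of the cube -/

/-- If all swaps of a compatible family of partial assignments change the value of a function by a
fixed nonzero amount, then the function takes more values than there are swaps. -/
theorem card_lt_card_of_compatible {V : Finset ℕ} {k b : ℕ} {F : Finset ℕ → ℝ} {T : Finset ℝ}
    (hT : ∀ x ∈ V.powersetCard k, F x ∈ T) (L : Finset (ℕ × ℕ × Finset ℕ))
    (A B : ℕ × ℕ × Finset ℕ → Finset ℕ)
    (hL : ∀ g ∈ L, IsSensitiveSwap V k F g)
    (hpair : ∀ g ∈ L, ∀ g' ∈ L, g ≠ g' → Disjoint (swapPair g) (swapPair g'))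
    (hA : ∀ g ∈ L, A g ⊆ g.2.2)
    (hAB : ∀ g ∈ L, (A g).card + (B g).card ≤ b)
    (hcompat : ∀ g ∈ L, ∀ g' ∈ L,
      Disjoint (A g) (B g') ∧ Disjoint (swapPair g) (A g') ∧ Disjoint (swapPair g) (B g'))
    (hconst : ∀ g ∈ L, ∀ w ⊆ V, g.1 ∉ w → g.2.1 ∉ w → w.card + 1 = k → A g ⊆ w →
      Disjoint (B g) w → F (insert g.1 w) - F (insert g.2.1 w) =
        F (insert g.1 g.2.2) - F (insert g.2.1 g.2.2))
    (hk : L.card * (b + 2) ≤ k) (hV : k + L.card * (b + 2) ≤ V.card) :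
    L.card < T.card := by
  set δ : ℕ × ℕ × Finset ℕ → ℝ := fun g => F (insert g.1 g.2.2) - F (insert g.2.1 g.2.2) with hδ
  set K := L.biUnion A with hK
  set U := L.biUnion fun g => swapPair g ∪ (A g ∪ B g) with hU
  have hUcard : U.card ≤ L.card * (b + 2) := card_biUnion_le_card_mul _ _ _ fun g hg => by
    have h1 := card_union_le (swapPair g) (A g ∪ B g)
    have h2 := card_union_le (A g) (B g)
    have h3 := hAB g hg
    have h4 := card_swapPair_le g
    omega
  have hKcard : K.card ≤ L.card * b := card_biUnion_le_card_mul _ _ _ fun g hg => by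
    have h3 := hAB g hg
    omega
  have hmul : L.card * (b + 2) = L.card * b + 2 * L.card := by ring
  -- Padding by unused coordinates: `K`, `R` and one coordinate from each pair together have weight
  -- `k`.
  obtain ⟨R, hRU, hR⟩ : ∃ R ⊆ V \ U, R.card = k - L.card - K.card := by
    apply exists_subset_card_eq
    have := le_card_sdiff U V
    omega
  have hRV : R ⊆ V := hRU.trans sdiff_subset
  have hRd : ∀ g ∈ L, ∀ u ∈ R, u ∉ swapPair g ∧ u ∉ A g ∧ u ∉ B g := fun g hg u hu => by
    have := (mem_sdiff.1 (hRU hu)).2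
    simp only [hU, mem_biUnion, not_exists, not_and, mem_union, not_or] at this
    exact this g hg
  have hi : ∀ g, g.1 ∈ swapPair g := fun g => by simp [swapPair]
  have hj : ∀ g, g.2.1 ∈ swapPair g := fun g => by simp [swapPair]
  -- The swaps in `I` contribute their first coordinate and those in `I'` their second. With `I' = L
  -- \ I` this is a point of the slice.
  set w : Finset (ℕ × ℕ × Finset ℕ) → Finset (ℕ × ℕ × Finset ℕ) → Finset ℕ := fun I I' =>
    (K ∪ R) ∪ (I.image (fun g => g.1) ∪ I'.image (fun g => g.2.1)) with hw
  have hpt : ∀ g ∈ L, ∀ g' ∈ L, ∀ u ∈ swapPair g, u ∈ swapPair g' → g = g' :=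
    fun g hg g' hg' u hu hu' => by
      by_contra hne
      exact disjoint_left.1 (hpair g hg g' hg' hne) hu hu'
  have hKV : K ⊆ V := biUnion_subset.2 fun g hg => (hA g hg).trans (hL g hg).subset
  have hnotK : ∀ g ∈ L, ∀ u ∈ swapPair g, u ∉ K ∪ R := fun g hg u hu h => by
    rcases mem_union.1 h with h | h
    · obtain ⟨g', hg', h'⟩ := mem_biUnion.1 h
      exact disjoint_left.1 (hcompat g hg g' hg').2.1 hu h'
    · exact (hRd g hg u h).1 hu
  have hwV : ∀ I ⊆ L, ∀ I' ⊆ L, w I I' ⊆ V := fun I hI I' hI' =>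
    union_subset (union_subset hKV hRV) (union_subset
      (image_subset_iff.2 fun g hg => (hL g (hI hg)).fst_mem)
      (image_subset_iff.2 fun g hg => (hL g (hI' hg)).snd_mem))
  have hwmem : ∀ I I' u, u ∈ w I I' →
      u ∈ K ∪ R ∨ (∃ g ∈ I, g.1 = u) ∨ ∃ g ∈ I', g.2.1 = u := fun I I' u hu => by
    rcases mem_union.1 hu with hu | hu
    · exact Or.inl hu
    · rw [mem_union, mem_image, mem_image] at hu
      exact Or.inr hu
  have hwnot : ∀ I ⊆ L, ∀ I' ⊆ L, ∀ g ∈ L, g ∉ I → g ∉ I' → ∀ u ∈ swapPair g, u ∉ w I I' :=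
    fun I hI I' hI' g hg h h' u hu hmem => by
      rcases hwmem I I' u hmem with hmem | ⟨a, ha, rfl⟩ | ⟨a, ha, rfl⟩
      · exact hnotK g hg u hu hmem
      · exact h (hpt g hg a (hI ha) _ hu (hi a) ▸ ha)
      · exact h' (hpt g hg a (hI' ha) _ hu (hj a) ▸ ha)
  have hwcard : ∀ I ⊆ L, ∀ I' ⊆ L, Disjoint I I' →
      (w I I').card = K.card + R.card + (I.card + I'.card) := fun I hI I' hI' hd => by
    have hKR : Disjoint K R := disjoint_left.2 fun u hu huR => by
      obtain ⟨g, hg, h⟩ := mem_biUnion.1 hu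
      exact (hRd g hg u huR).2.1 h
    have h1 : Disjoint (I.image (fun g => g.1)) (I'.image (fun g => g.2.1)) := by
      refine disjoint_left.2 fun u hu hu' => ?_
      obtain ⟨a, ha, rfl⟩ := mem_image.1 hu
      obtain ⟨a', ha', h⟩ := mem_image.1 hu'
      have := hpt a (hI ha) a' (hI' ha') _ (hi a) (h ▸ hj a')
      exact disjoint_left.1 hd ha (this ▸ ha')
    have h2 : Disjoint (K ∪ R) (I.image (fun g => g.1) ∪ I'.image (fun g => g.2.1)) := by
      refine disjoint_right.2 fun u hu => ?_
      rcases mem_union.1 hu with hu | hu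
      · obtain ⟨a, ha, rfl⟩ := mem_image.1 hu
        exact hnotK a (hI ha) _ (hi a)
      · obtain ⟨a, ha, rfl⟩ := mem_image.1 hu
        exact hnotK a (hI' ha) _ (hj a)
    simp only [hw]
    rw [card_union_of_disjoint h2, card_union_of_disjoint hKR, card_union_of_disjoint h1,
      card_image_of_injOn, card_image_of_injOn]
    · exact fun a ha a' ha' h => hpt a (hI' ha) a' (hI' ha') _ (hj a)
        ((show a.2.1 = a'.2.1 from h) ▸ hj a')
    · exact fun a ha a' ha' h => hpt a (hI ha) a' (hI ha') _ (hi a)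
        ((show a.1 = a'.1 from h) ▸ hi a')
  -- Moving one swap `g` from `I'` to `I` exchanges its two coordinates over a background that
  -- respects `A g` and `B g`, so `hconst` gives the change.
  have hstep : ∀ I ⊆ L, ∀ I' ⊆ L, Disjoint I I' → I.card + I'.card + 1 = L.card → ∀ g ∈ L,
      g ∉ I → g ∉ I' → F (w (insert g I) I') - F (w I (insert g I')) = δ g := by
    intro I hI I' hI' hd hc g hg hgI hgI'
    have e1 : w (insert g I) I' = insert g.1 (w I I') := by
      simp only [hw, image_insert, insert_union, union_insert]
    have e2 : w I (insert g I') = insert g.2.1 (w I I') := by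
      simp only [hw, image_insert, union_insert]
    rw [e1, e2]
    refine hconst g hg _ (hwV I hI I' hI') (hwnot I hI I' hI' g hg hgI hgI' _ (hi g))
      (hwnot I hI I' hI' g hg hgI hgI' _ (hj g)) ?_ ?_ ?_
    · rw [hwcard I hI I' hI' hd]
      omega
    · exact ((subset_biUnion_of_mem A hg).trans subset_union_left).trans subset_union_left
    · refine disjoint_left.2 fun u hu hmem => ?_
      rcases hwmem I I' u hmem with hmem | ⟨a, ha, rfl⟩ | ⟨a, ha, rfl⟩
      · rcases mem_union.1 hmem with hmem | hmem
        · obtain ⟨g', hg', h'⟩ := mem_biUnion.1 hmem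
          exact disjoint_left.1 (hcompat g' hg' g hg).1 h' hu
        · exact (hRd g hg u hmem).2.2 hu
      · exact disjoint_left.1 (hcompat a (hI ha) g hg).2.2 (hi a) hu
      · exact disjoint_left.1 (hcompat a (hI' ha) g hg).2.2 (hj a) hu
  have hsum : ∀ I : Finset (ℕ × ℕ × Finset ℕ), I ⊆ L →
      F (w I (L \ I)) = F (w ∅ L) + ∑ g ∈ I, δ g := by
    intro I
    induction I using Finset.induction_on with
    | empty => simp
    | insert g I hgI ih =>
      intro hI
      have hIL : I ⊆ L := (subset_insert _ _).trans hI
      have hgL := hI (mem_insert_self g I)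
      have hins : insert g (L \ insert g I) = L \ I := by
        ext a; simp only [mem_insert, mem_sdiff, not_or]
        by_cases h : a = g
        · subst h; simp [hgI, hgL]
        · simp [h]
      have hd : Disjoint I (L \ insert g I) :=
        disjoint_sdiff.mono_right (sdiff_subset_sdiff subset_rfl (subset_insert _ _))
      have hcard : I.card + (L \ insert g I).card + 1 = L.card := by
        rw [card_sdiff_of_subset hI, card_insert_of_notMem hgI]
        have := card_le_card hI
        rw [card_insert_of_notMem hgI] at this
        omega
      have h := hstep I hIL _ sdiff_subset hd hcard g hgL hgI (by simp)
      rw [hins, ih hIL] at h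
      rw [sum_insert hgI]
      linarith
  have hlt := card_lt_card_image_subsetSum L δ fun g hg => sub_ne_zero.2 (hL g hg).ne
  refine hlt.trans_le ?_
  rw [← card_image_of_injective _ (add_right_injective (F (w ∅ L)))]
  refine card_le_card fun v hv => ?_
  simp only [mem_image, mem_powerset] at hv
  obtain ⟨_, ⟨I, hI, rfl⟩, rfl⟩ := hv
  rw [← hsum I hI]
  refine hT _ (mem_powersetCard.2 ⟨hwV I hI _ sdiff_subset, ?_⟩)
  rw [hwcard I hI _ sdiff_subset disjoint_sdiff, card_sdiff_of_subset hI]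
  have := card_le_card hI
  omega

/-- Bounded degree functions taking boundedly many values on slices that are far from both ends of
the cube depend on a bounded number of coordinates. -/
theorem exists_dependsOnlyOn_of_large (e a : ℕ) :
    ∃ C m : ℕ, ∀ (V : Finset ℕ) (k : ℕ) (c : Finset ℕ → ℝ) (T : Finset ℝ),
      C ≤ k → k + C ≤ V.card → DegreeLT e c → T.card ≤ a →
      (∀ x ∈ V.powersetCard k, multilinearEval c x ∈ T) →
      ∃ J : Finset ℕ, J.card ≤ m ∧ DependsOnlyOn V k J (multilinearEval c) := by
  induction e generalizing a with
  | zero =>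
    refine ⟨0, 0, fun V k c T _ _ hc _ _ => ⟨∅, by simp, fun x _ y _ _ => ?_⟩⟩
    simp [multilinearEval, fun S => hc S (Nat.zero_le _)]
  | succ e ih =>
    -- The differences have their values in `T - T`, of size at most `a * a`.
    obtain ⟨C, m, hCm⟩ := ih (a * a)
    obtain ⟨M, hM⟩ := exists_compatible m a
    -- The `C + 1` allows for the loss of weight in passing to differences; `a * (m + 2)` makes room
    -- for `a` pairs with `m` fixed coordinates each.
    refine ⟨C + 1 + a * (m + 2), 2 * M, fun V k c T hk hV hc hTa hT => ?_⟩
    by_contra! hno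
    obtain ⟨G, hGM, hG, hGd⟩ := exists_pairwiseDisjoint_isSensitiveSwap hno
    have hder : ∀ g ∈ G, ∃ J : Finset ℕ, J.card ≤ m ∧
        DependsOnlyOn (V \ swapPair g) (k - 1) J
          (multilinearEval (swapCoeff e c g.1 g.2.1)) := by
      intro g hg
      have hs := hG g hg
      refine hCm _ _ _ ((T ×ˢ T).image fun q => q.1 - q.2) (by omega) ?_
        (degreeLT_swapCoeff _ _ _ _) ?_ ?_
      · have h1 := le_card_sdiff (swapPair g) V
        have h2 := card_swapPair_le g
        have h3 : swapPair g ⊆ V := by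
          simp [swapPair, insert_subset_iff, hs.fst_mem, hs.snd_mem]
        have h4 : 0 < a := by
          have : multilinearEval c (insert g.1 g.2.2) ∈ T := hT _ (mem_powersetCard.2
            ⟨insert_subset hs.fst_mem hs.subset, by
              rw [card_insert_of_notMem hs.fst_notMem, hs.card]⟩)
          have := card_pos.2 ⟨_, this⟩
          omega
        have h5 : 0 < a * (m + 2) := by positivity
        omega
      · exact card_image_le.trans (by rw [card_product]; exact Nat.mul_le_mul hTa hTa)
      · intro x hx
        rw [mem_powersetCard, subset_sdiff] at hx
        have hi : g.1 ∉ x := fun h => disjoint_left.1 hx.1.2 h (by simp [swapPair])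
        have hj : g.2.1 ∉ x := fun h => disjoint_left.1 hx.1.2 h (by simp [swapPair])
        rw [← multilinearEval_sub_multilinearEval hc hi hj]
        refine mem_image.2 ⟨(_, _), mem_product.2 ⟨hT _ ?_, hT _ ?_⟩, rfl⟩
        · rw [mem_powersetCard, card_insert_of_notMem hi]
          exact ⟨insert_subset hs.fst_mem hx.1.1, by omega⟩
        · rw [mem_powersetCard, card_insert_of_notMem hj]
          exact ⟨insert_subset hs.snd_mem hx.1.1, by omega⟩
    choose! J hJm hJ using hder
    have hdz : ∀ g ∈ G, Disjoint (swapPair g) g.2.2 := fun g hg => by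
      simp [swapPair, (hG g hg).fst_notMem, (hG g hg).snd_notMem]
    -- The partial assignment of `g` freezes the values of its witness `g.2.2` on `J g`, off the
    -- pair.
    obtain ⟨L, hLG, hLa, hLc⟩ := hM G swapPair (fun g => g.2.2 ∩ J g)
      (fun g => J g \ (g.2.2 ∪ swapPair g)) hGM.ge (fun g _ => card_swapPair_le g) hGd
      (fun g hg => by
        rw [← card_union_of_disjoint]
        · refine (card_le_card (union_subset inter_subset_right sdiff_subset)).trans (hJm g hg)
        · exact disjoint_sdiff.mono_left (inter_subset_left.trans subset_union_left))
      (fun g hg => ⟨disjoint_sdiff.mono_left (inter_subset_left.trans subset_union_left),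
        (hdz g hg).mono_right inter_subset_left,
        disjoint_sdiff.mono_left subset_union_right⟩)
    have := card_lt_card_of_compatible (b := m) hT L (fun g => g.2.2 ∩ J g)
      (fun g => J g \ (g.2.2 ∪ swapPair g)) (fun g hg => hG g (hLG hg))
      (fun g hg g' hg' => hGd g (hLG hg) g' (hLG hg')) (fun g _ => inter_subset_left)
      (fun g hg => by
        rw [← card_union_of_disjoint]
        · refine (card_le_card (union_subset inter_subset_right sdiff_subset)).trans
            (hJm g (hLG hg))
        · exact disjoint_sdiff.mono_left (inter_subset_left.trans subset_union_left))
      hLc ?_ (by rw [hLa]; omega) (by rw [hLa]; omega)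
    · omega
    · intro g hg w hwV hiw hjw hwk hAw hBw
      have hs := hG g (hLG hg)
      rw [multilinearEval_sub_multilinearEval hc hiw hjw,
        multilinearEval_sub_multilinearEval hc hs.fst_notMem hs.snd_notMem]
      have hdw : Disjoint (swapPair g) w := by simp [swapPair, hiw, hjw]
      refine hJ g (hLG hg) w ?_ _ ?_ ?_
      · exact mem_powersetCard.2 ⟨subset_sdiff.2 ⟨hwV, hdw.symm⟩, by omega⟩
      · have := hs.card
        exact mem_powersetCard.2 ⟨subset_sdiff.2 ⟨hs.subset, (hdz g (hLG hg)).symm⟩, by omega⟩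
      · refine Subset.antisymm (fun u hu => ?_) fun u hu =>
          mem_inter.2 ⟨hAw hu, (mem_inter.1 hu).2⟩
        rw [mem_inter] at hu ⊢
        refine ⟨?_, hu.2⟩
        by_contra hz
        refine disjoint_left.1 hBw (mem_sdiff.2 ⟨hu.2, ?_⟩) hu.1
        rw [mem_union, not_or]
        exact ⟨hz, disjoint_right.1 hdw hu.1⟩

/-! ### Ramsey's theorem for uniform hypergraphs -/

/-- Ramsey's theorem for `s`-uniform hypergraphs and two colours. -/
theorem exists_monochromatic (s N : ℕ) :
    ∃ M : ℕ, ∀ Y : Finset ℕ, M ≤ Y.card → ∀ χ : Finset ℕ → Prop, ∃ Z ⊆ Y, N ≤ Z.card ∧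
      ∃ a : Prop, ∀ U ⊆ Z, U.card = s → (χ U ↔ a) := by
  classical
  induction s generalizing N with
  | zero =>
    refine ⟨N, fun Y hY χ => ⟨Y, subset_rfl, hY, χ ∅, fun U _ hU => ?_⟩⟩
    rw [card_eq_zero.1 hU]
  | succ s ih =>
    have key : ∀ L : ℕ, ∃ M : ℕ, ∀ Y : Finset ℕ, M ≤ Y.card → ∀ χ : Finset ℕ → Prop,
        ∃ Z ⊆ Y, L ≤ Z.card ∧ ∃ a : ℕ → Prop, ∀ v ∈ Z, ∀ U ⊆ Z, (∀ u ∈ U, v < u) →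
          U.card = s → (χ (insert v U) ↔ a v) := by
      intro L
      induction L with
      | zero => exact ⟨0, fun Y _ χ => ⟨∅, by simp, by simp, fun _ => True, by simp⟩⟩
      | succ L ihL =>
        obtain ⟨M₁, hM₁⟩ := ihL
        obtain ⟨M₂, hM₂⟩ := ih M₁
        refine ⟨M₂ + 1, fun Y hY χ => ?_⟩
        have hne : Y.Nonempty := card_pos.1 (by omega)
        set v := Y.min' hne with hv
        have hvY : v ∈ Y := min'_mem _ _
        obtain ⟨Y₁, hY₁, hY₁c, a, ha⟩ := hM₂ (Y.erase v)
          (by rw [card_erase_of_mem hvY]; omega) (fun U => χ (insert v U))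
        obtain ⟨Z, hZ, hZc, b, hb⟩ := hM₁ Y₁ hY₁c χ
        have hlt : ∀ u ∈ Z, v < u := fun u hu => by
          have := mem_erase.1 (hY₁ (hZ hu))
          exact lt_of_le_of_ne (min'_le _ _ this.2) (Ne.symm this.1)
        have hvZ : v ∉ Z := fun h => lt_irrefl _ (hlt v h)
        refine ⟨insert v Z, insert_subset hvY ((hZ.trans hY₁).trans (erase_subset _ _)),
          by rw [card_insert_of_notMem hvZ]; omega, fun u => if u = v then a else b u, ?_⟩
        intro u hu U hU hUlt hUs
        have hvU : v ∉ U := fun h => by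
          have h1 := hUlt v h
          rcases mem_insert.1 hu with h2 | h2
          · omega
          · have := hlt u h2
            omega
        have hUZ : U ⊆ Z := fun x hx => (mem_insert.1 (hU hx)).resolve_left fun h => hvU (h ▸ hx)
        by_cases h : u = v
        · simp only [h, if_true]
          exact ha U (hUZ.trans hZ) hUs
        · simp only [h, if_false]
          exact hb u ((mem_insert.1 hu).resolve_left h) U hUZ hUlt hUs
    -- In the set from `key` the colour depends only on the least element, so one of the two colours
    -- of least elements occurs `N` times.
    obtain ⟨M, hM⟩ := key (2 * N)
    refine ⟨M, fun Y hY χ => ?_⟩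
    obtain ⟨Z, hZ, hZc, a, ha⟩ := hM Y hY χ
    have hmin : ∀ Z' ⊆ Z, ∀ b : Prop, (∀ v ∈ Z', (a v ↔ b)) →
        ∀ U ⊆ Z', U.card = s + 1 → (χ U ↔ b) := by
      intro Z' hZ' b hb U hU hUs
      have hne : U.Nonempty := card_pos.1 (by omega)
      have hmem := min'_mem U hne
      rw [← insert_erase hmem, ha _ (hZ' (hU hmem)) _ (((erase_subset _ _).trans hU).trans hZ'),
        hb _ (hU hmem)]
      · intro u hu
        rw [mem_erase] at hu
        exact lt_of_le_of_ne (min'_le _ _ hu.2) (Ne.symm hu.1)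
      · rw [card_erase_of_mem hmem, hUs]; rfl
    have hsplit := card_filter_add_card_filter_not (s := Z) a
    rcases le_or_gt N (Z.filter a).card with h | h
    · exact ⟨_, (filter_subset a Z).trans hZ, h, True, hmin _ (filter_subset _ _) _
        fun v hv => by simp [(mem_filter.1 hv).2]⟩
    · exact ⟨Z.filter fun v => ¬ a v, (filter_subset _ Z).trans hZ, by omega, False,
        hmin _ (filter_subset _ _) _ fun v hv => by simp [(mem_filter.1 hv).2]⟩

/-- Ramsey's theorem for a bounded number of simultaneous colourings, of possibly different
uniformities. -/
theorem exists_forall_monochromatic (q k N : ℕ) :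
    ∃ M : ℕ, ∀ Y : Finset ℕ, M ≤ Y.card → ∀ I : Finset (Finset ℕ), I.card ≤ q →
      ∀ s : Finset ℕ → ℕ, (∀ i ∈ I, s i ≤ k) → ∀ χ : Finset ℕ → Finset ℕ → Prop,
      ∃ Z ⊆ Y, N ≤ Z.card ∧
        ∀ i ∈ I, ∃ a : Prop, ∀ U ⊆ Z, U.card = s i → (χ i U ↔ a) := by
  choose R hR using exists_monochromatic
  induction q with
  | zero =>
    refine ⟨N, fun Y hY I hI s _ χ => ⟨Y, subset_rfl, hY, fun i hi => ?_⟩⟩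
    rw [card_eq_zero.1 (Nat.le_zero.1 hI)] at hi
    simp at hi
  | succ q ih =>
    obtain ⟨M, hM⟩ := ih
    refine ⟨∑ s ∈ range (k + 1), R s M, fun Y hY I hI s hs χ => ?_⟩
    rcases I.eq_empty_or_nonempty with rfl | ⟨i, hi⟩
    · obtain ⟨Z, hZ, hZc, -⟩ := hR 0 M Y
        ((single_le_sum (f := fun s => R s M) (fun _ _ => Nat.zero_le _)
          (mem_range.2 (Nat.succ_pos k))).trans hY) fun _ => True
      obtain ⟨Z', hZ', hZ'c, h⟩ := hM Z hZc ∅ (by simp) s (by simp) χ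
      exact ⟨Z', hZ'.trans hZ, hZ'c, h⟩
    · obtain ⟨Z, hZ, hZc, a, ha⟩ := hR (s i) M Y
        ((single_le_sum (f := fun s => R s M) (fun _ _ => Nat.zero_le _)
          (mem_range.2 (Nat.lt_succ_of_le (hs i hi)))).trans hY) (χ i)
      obtain ⟨Z', hZ', hZ'c, h⟩ := hM Z hZc (I.erase i) (by rw [card_erase_of_mem hi]; omega) s
        (fun j hj => hs j (mem_of_mem_erase hj)) χ
      refine ⟨Z', hZ'.trans hZ, hZ'c, fun j hj => ?_⟩
      by_cases hji : j = i
      · subst hji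
        exact ⟨a, fun U hU => ha U (hU.trans hZ')⟩
      · exact h j (mem_erase.2 ⟨hji, hj⟩)

/-! ### Möbius inversion and Boolean functions on Hamming balls -/

/-- The coefficients of the multilinear polynomial with values `F`. -/
def mobiusCoeff (F : Finset ℕ → ℝ) (S : Finset ℕ) : ℝ :=
  ∑ R ∈ S.powerset, (-1) ^ (S.card + R.card) * F R

theorem mobiusCoeff_insert (F : Finset ℕ → ℝ) {i : ℕ} {S : Finset ℕ} (hi : i ∉ S) :
    mobiusCoeff F (insert i S) = mobiusCoeff (fun R => F (insert i R)) S - mobiusCoeff F S := by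
  simp only [mobiusCoeff, sum_powerset_insert hi]
  rw [add_comm, sub_eq_add_neg, ← sum_neg_distrib]
  congr 1
  · refine sum_congr rfl fun R hR => ?_
    rw [card_insert_of_notMem hi, card_insert_of_notMem fun h => hi (mem_powerset.1 hR h)]
    ring
  · refine sum_congr rfl fun R _ => ?_
    rw [card_insert_of_notMem hi]
    ring

theorem multilinearEval_mobiusCoeff (F : Finset ℕ → ℝ) (T : Finset ℕ) :
    multilinearEval (mobiusCoeff F) T = F T := by
  induction T using Finset.induction_on generalizing F with
  | empty => simp [multilinearEval, mobiusCoeff]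
  | insert i T hi ih =>
    rw [multilinearEval_insert _ hi, ih]
    have : multilinearEval (fun S => mobiusCoeff F (insert i S)) T =
        multilinearEval (mobiusCoeff fun R => F (insert i R)) T -
          multilinearEval (mobiusCoeff F) T := by
      simp only [multilinearEval, ← sum_sub_distrib]
      exact sum_congr rfl fun S hS => mobiusCoeff_insert F fun h => hi (mem_powerset.1 hS h)
    rw [this, ih, ih]
    ring

/-- The alternating sum of a polynomial of low degree over the points obtained from a large number
of disjoint swaps vanishes. -/
theorem sum_swaps_eq_zero {e : ℕ} {c : Finset ℕ → ℝ} (hc : DegreeLT e c) {y : ℕ → ℕ}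
    {S U : Finset ℕ} (he : e ≤ S.card) (hy : Set.InjOn y S) (hyS : Disjoint S (S.image y))
    (hSU : Disjoint S U) (hyU : Disjoint (S.image y) U) :
    ∑ R ∈ S.powerset, (-1) ^ (S.card + R.card) *
      multilinearEval c (R ∪ (S \ R).image y ∪ U) = 0 := by
  induction S using Finset.induction_on generalizing c e with
  | empty =>
    rw [card_empty, Nat.le_zero] at he
    subst he
    simp [multilinearEval, fun S => hc S (Nat.zero_le _)]
  | insert i S hi ih =>
    rcases e with _ | e
    · simp [multilinearEval, fun S => hc S (Nat.zero_le _)]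
    rw [card_insert_of_notMem hi] at he
    have hsub : S ⊆ insert i S := subset_insert _ _
    rw [disjoint_insert_left] at hSU
    rw [image_insert, disjoint_insert_left] at hyU
    rw [image_insert, disjoint_insert_left, disjoint_insert_right, mem_insert, not_or] at hyS
    have hyi : y i ∉ S.image y := fun h => by
      obtain ⟨j, hj, hji⟩ := mem_image.1 h
      exact hi (hy (by simp [hj]) (by simp) hji ▸ hj)
    have := ih (degreeLT_swapCoeff e c i (y i)) (by omega) (hy.mono (by simp)) hyS.2.2 hSU.2 hyU.2
    -- The terms of `R` and `insert i R` have opposite signs and merge into a value of the swap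
    -- difference, to which the induction hypothesis applies.
    rw [← this, sum_powerset_insert hi, ← sum_add_distrib]
    refine sum_congr rfl fun R hR => ?_
    rw [mem_powerset] at hR
    have hiR : i ∉ R := fun h => hi (hR h)
    have e1 : R ∪ (insert i S \ R).image y ∪ U = insert (y i) (R ∪ (S \ R).image y ∪ U) := by
      rw [insert_sdiff_of_notMem _ hiR, image_insert, union_insert, insert_union]
    have e2 : insert i R ∪ (insert i S \ insert i R).image y ∪ U =
        insert i (R ∪ (S \ R).image y ∪ U) := by
      rw [insert_sdiff_insert, sdiff_insert_of_notMem hi, insert_union, insert_union]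
    rw [e1, e2, card_insert_of_notMem hi, card_insert_of_notMem hiR,
      ← multilinearEval_sub_multilinearEval hc]
    · ring
    · simp only [mem_union, not_or]
      exact ⟨⟨hiR, fun h => hyS.1.2 (image_subset_image sdiff_subset h)⟩, hSU.1⟩
    · simp only [mem_union, not_or]
      exact ⟨⟨fun h => hyS.2.1 (hR h), fun h => hyi (image_subset_image sdiff_subset h)⟩, hyU.1⟩

theorem multilinearEval_congr {c c' : Finset ℕ → ℝ} {x : Finset ℕ} (h : ∀ S ⊆ x, c S = c' S) :
    multilinearEval c x = multilinearEval c' x :=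
  sum_congr rfl fun S hS => h S (mem_powerset.1 hS)

/-- The coefficients of the square of a multilinear polynomial. -/
def sqCoeff (c : Finset ℕ → ℝ) (R : Finset ℕ) : ℝ :=
  ∑ p ∈ (R.powerset ×ˢ R.powerset).filter fun p => p.1 ∪ p.2 = R, c p.1 * c p.2

theorem multilinearEval_sqCoeff (c : Finset ℕ → ℝ) (T : Finset ℕ) :
    multilinearEval (sqCoeff c) T = multilinearEval c T ^ 2 := by
  rw [sq, multilinearEval, multilinearEval, sum_mul_sum, ← sum_product',
    ← sum_fiberwise_of_maps_to (g := fun p : Finset ℕ × Finset ℕ => p.1 ∪ p.2) (t := T.powerset)]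
  · refine sum_congr rfl fun R hR => sum_congr ?_ fun _ _ => rfl
    ext p
    simp only [mem_filter, mem_product, mem_powerset]
    rw [mem_powerset] at hR
    constructor
    · rintro ⟨⟨h1, h2⟩, h⟩
      exact ⟨⟨h1.trans hR, h2.trans hR⟩, h⟩
    · rintro ⟨_, rfl⟩
      exact ⟨⟨subset_union_left, subset_union_right⟩, rfl⟩
  · intro p hp
    rw [mem_product, mem_powerset, mem_powerset] at hp
    exact mem_powerset.2 (union_subset hp.1 hp.2)

theorem degreeLT_sqCoeff {d : ℕ} {c : Finset ℕ → ℝ} (hc : DegreeLT (d + 1) c) :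
    DegreeLT (2 * d + 1) (sqCoeff c) := by
  intro R hR
  refine sum_eq_zero fun p hp => ?_
  have hp := (mem_filter.1 hp).2
  have := card_union_le p.1 p.2
  rw [hp] at this
  rcases le_or_gt (d + 1) p.1.card with h | h
  · rw [hc _ h, zero_mul]
  · rw [hc p.2 (by omega), mul_zero]

/-- The values on subsets of `S` determine `c S`, so by induction the coefficients up to degree `e`
vanish on `W`; the higher ones vanish by assumption. -/
theorem multilinearEval_eq_zero_of_ball {e : ℕ} {c : Finset ℕ → ℝ} (hc : DegreeLT (e + 1) c)
    {W : Finset ℕ} (h : ∀ T ⊆ W, T.card ≤ e → multilinearEval c T = 0) :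
    ∀ T ⊆ W, multilinearEval c T = 0 := by
  have hcoeff : ∀ S, S ⊆ W → c S = 0 := by
    intro S
    induction S using Finset.strongInduction with
    | H S ih =>
      intro hS
      rcases le_or_gt S.card e with hSe | hSe
      · have := h S hS hSe
        rwa [multilinearEval, ← add_sum_erase _ _ (mem_powerset_self S), sum_eq_zero,
          add_zero] at this
        intro R hR
        rw [mem_erase, mem_powerset] at hR
        exact ih R (hR.2.ssubset_of_ne hR.1) (hR.2.trans hS)
      · exact hc S hSe
  exact fun T hT => sum_eq_zero fun S hS => hcoeff S ((mem_powerset.1 hS).trans hT)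

/-- A polynomial of degree at most `d` which is Boolean on a Hamming ball of radius `2 d` is
Boolean on the whole cube. -/
theorem boolean_of_boolean_ball {d : ℕ} {c : Finset ℕ → ℝ} (hc : DegreeLT (d + 1) c)
    {W : Finset ℕ}
    (h : ∀ T ⊆ W, T.card ≤ 2 * d → multilinearEval c T = 0 ∨ multilinearEval c T = 1) :
    ∀ T ⊆ W, multilinearEval c T = 0 ∨ multilinearEval c T = 1 := by
  have hsub : ∀ T, multilinearEval (fun S => sqCoeff c S - c S) T =
      multilinearEval c T ^ 2 - multilinearEval c T := fun T => by
    rw [← multilinearEval_sqCoeff]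
    simp only [multilinearEval, sum_sub_distrib]
  have hdeg : DegreeLT (2 * d + 1) fun S => sqCoeff c S - c S := fun S hS => by
    simp [degreeLT_sqCoeff hc S hS, hc S (by omega)]
  intro T hT
  have := multilinearEval_eq_zero_of_ball hdeg (W := W) (fun T hT hTd => by
    rw [hsub]
    rcases h T hT hTd with h | h <;> simp [h]) T hT
  rw [hsub] at this
  have : multilinearEval c T * (multilinearEval c T - 1) = 0 := by linarith
  rcases mul_eq_zero.1 this with h | h
  · exact Or.inl h
  · exact Or.inr (by linarith)

/-- Boolean functions of bounded degree on the cube depend on a bounded number of coordinates. -/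
theorem exists_dependsOnly_cube (d : ℕ) :
    ∃ m : ℕ, ∀ (W : Finset ℕ) (c : Finset ℕ → ℝ), DegreeLT (d + 1) c →
      (∀ T ⊆ W, multilinearEval c T = 0 ∨ multilinearEval c T = 1) →
      ∃ J : Finset ℕ, J.card ≤ m ∧ ∀ x ⊆ W, ∀ y ⊆ W, x ∩ J = y ∩ J →
        multilinearEval c x = multilinearEval c y := by
  obtain ⟨C, m, h⟩ := exists_dependsOnlyOn_of_large (d + 1) 2
  refine ⟨m, fun W c hc hbool => ?_⟩
  -- Dummy coordinates turn the cube on `W` into a slice far from both ends. Even outside `J` enough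
  -- of them remain to complete any subset of `W`.
  obtain ⟨E, hE⟩ : ∃ E : Finset ℕ, Disjoint W E ∧ E.card = W.card + 2 * C + m := by
    obtain ⟨E, hEW, hE⟩ := Infinite.exists_superset_card_eq W (W.card + (W.card + 2 * C + m))
      (by omega)
    exact ⟨E \ W, disjoint_sdiff, by rw [card_sdiff_of_subset hEW, hE]; omega⟩
  have hev : ∀ x, multilinearEval (fun S => if S ⊆ W then c S else 0) x =
      multilinearEval c (x ∩ W) := fun x => by
    simp only [multilinearEval]
    rw [← sum_filter]
    refine sum_congr ?_ fun _ _ => rfl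
    ext S
    simp only [mem_filter, mem_powerset, subset_inter_iff]
  obtain ⟨J, hJm, hJ⟩ := h (W ∪ E) (W.card + C) (fun S => if S ⊆ W then c S else 0) {0, 1}
    (by omega) (by rw [card_union_of_disjoint hE.1]; omega)
    (fun S hS => by simp [hc S hS]) card_le_two
    (fun x _ => by rw [hev]; simpa using hbool _ inter_subset_right)
  refine ⟨J, hJm, fun x hx y hy hxy => ?_⟩
  have hext : ∀ x ⊆ W, ∃ z ∈ (W ∪ E).powersetCard (W.card + C), z ∩ W = x ∧ z ∩ J = x ∩ J := by
    intro x hx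
    obtain ⟨D, hDE, hD⟩ : ∃ D ⊆ E \ J, D.card = W.card + C - x.card := by
      apply exists_subset_card_eq
      have := le_card_sdiff J E
      omega
    have hDW : Disjoint D W := hE.1.symm.mono_left (hDE.trans sdiff_subset)
    have hDJ : Disjoint D J := disjoint_sdiff.symm.mono_left hDE
    refine ⟨x ∪ D, mem_powersetCard.2 ⟨union_subset_union hx (hDE.trans sdiff_subset), ?_⟩, ?_, ?_⟩
    · have := card_le_card hx
      rw [card_union_of_disjoint (hDW.symm.mono_left hx)]
      omega
    · rw [union_inter_distrib_right, disjoint_iff_inter_eq_empty.1 hDW, union_empty,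
        inter_eq_left.2 hx]
    · rw [union_inter_distrib_right, disjoint_iff_inter_eq_empty.1 hDJ, union_empty]
  obtain ⟨x', hx', hx'W, hx'J⟩ := hext x hx
  obtain ⟨y', hy', hy'W, hy'J⟩ := hext y hy
  have := hJ x' hx' y' hy' (by rw [hx'J, hy'J, hxy])
  rwa [hev, hev, hx'W, hy'W] at this

/-! ### The upper bound -/

theorem exists_injOn_image_eq {S Z : Finset ℕ} (h : S.card = Z.card) :
    ∃ y : ℕ → ℕ, Set.InjOn y S ∧ S.image y = Z := by
  let φ := S.equivOfCardEq h
  refine ⟨fun n => if hn : n ∈ S then φ ⟨n, hn⟩ else 0, fun a ha b hb hab => ?_, ?_⟩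
  · have ha : a ∈ S := ha
    have hb : b ∈ S := hb
    simp only [ha, hb, dif_pos] at hab
    simpa using φ.injective (Subtype.ext hab)
  · refine eq_of_subset_of_card_le (image_subset_iff.2 fun a ha => ?_) ?_
    · simp only [ha, dif_pos]
      exact (φ ⟨a, ha⟩).2
    · refine card_le_card fun z hz => mem_image.2 ⟨φ.symm ⟨z, hz⟩, (φ.symm ⟨z, hz⟩).2, ?_⟩
      simp

/-- If `c` is constant on the completions of every small subset of `W` by elements of a disjoint
set `Z`, then the resulting function on the Hamming ball of radius `k` in `W` is given by a
polynomial of the same degree. -/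
theorem exists_degreeLT_of_completion {d k : ℕ} {c F : Finset ℕ → ℝ} (hc : DegreeLT (d + 1) c)
    {W Z : Finset ℕ} (hWZ : Disjoint W Z) (hZ : k ≤ Z.card)
    (hF : ∀ T ⊆ W, T.card ≤ k → ∀ U ⊆ Z, U.card = k - T.card → multilinearEval c (T ∪ U) = F T) :
    ∃ c' : Finset ℕ → ℝ, DegreeLT (d + 1) c' ∧
      ∀ T ⊆ W, T.card ≤ k → multilinearEval c' T = F T := by
  refine ⟨fun S => if d < S.card then 0 else mobiusCoeff F S,
    fun S hS => if_pos hS, fun T hT hTk => ?_⟩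
  rw [← multilinearEval_mobiusCoeff F T]
  refine multilinearEval_congr fun S hST => ?_
  split_ifs with hd
  swap
  · rfl
  have hSW := hST.trans hT
  have hSk : S.card ≤ k := (card_le_card hST).trans hTk
  obtain ⟨Z₁, hZ₁, hZ₁c⟩ := exists_subset_card_eq (hSk.trans hZ)
  obtain ⟨U, hU, hUc⟩ : ∃ U ⊆ Z \ Z₁, U.card = k - S.card := by
    apply exists_subset_card_eq
    rw [card_sdiff_of_subset hZ₁]
    omega
  obtain ⟨y, hy, hyZ⟩ := exists_injOn_image_eq hZ₁c.symm
  have hUZ : U ⊆ Z := hU.trans sdiff_subset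
  have hd₁ : Disjoint Z₁ U := disjoint_sdiff.mono_right hU
  -- Each point in this alternating sum is a completion of some `R ⊆ S` by elements of `Z` to weight
  -- `k`, so the sum is `mobiusCoeff F S`; it vanishes because `S.card > d`.
  have h0 := sum_swaps_eq_zero hc (S := S) (U := U) hd hy
    (by rw [hyZ]; exact hWZ.mono hSW hZ₁) (hWZ.mono hSW hUZ) (by rwa [hyZ])
  rw [← h0]
  refine sum_congr rfl fun R hR => ?_
  rw [mem_powerset] at hR
  have hsub : (S \ R).image y ⊆ Z₁ := hyZ ▸ image_subset_image sdiff_subset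
  have hRS := card_le_card hR
  rw [union_assoc, hF R (hR.trans hSW) (hRS.trans hSk) _ (union_subset (hsub.trans hZ₁) hUZ)]
  rw [card_union_of_disjoint (hd₁.mono_left hsub), hUc,
    card_image_of_injOn (hy.mono (by simp)), card_sdiff_of_subset hR]
  omega

/-- On every fixed slice of weight at least `2 d`, Boolean functions of degree at most `d` depend
on a bounded number of coordinates. -/
theorem exists_dependsOnlyOn_of_fixed {d k : ℕ} (hdk : 2 * d ≤ k) :
    ∃ m : ℕ, ∀ (V : Finset ℕ) (c : Finset ℕ → ℝ), DegreeLT (d + 1) c →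
      (∀ x ∈ V.powersetCard k, multilinearEval c x = 0 ∨ multilinearEval c x = 1) →
      ∃ J : Finset ℕ, J.card ≤ m ∧ DependsOnlyOn V k J (multilinearEval c) := by
  obtain ⟨m₀, hm₀⟩ := exists_dependsOnly_cube d
  set w := (m₀ + 1) * (k + 1) with hw
  -- One colouring for each `T ⊆ W`: sets of size `k - T.card` are coloured by the value of `f` at
  -- the completion of `T`.
  obtain ⟨M, hM⟩ := exists_forall_monochromatic (2 ^ w) k k
  refine ⟨max (2 * (m₀ + 1)) (w + M), fun V c hc hbool => ?_⟩
  by_contra! hno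
  have hV : w + M < V.card := by
    by_contra! hV
    refine hno V (hV.trans (le_max_right _ _)) fun x hx y hy hxy => ?_
    rw [mem_powersetCard] at hx hy
    rw [inter_eq_left.2 hx.1, inter_eq_left.2 hy.1] at hxy
    rw [hxy]
  obtain ⟨G, hGc, hG, hGd⟩ := exists_pairwiseDisjoint_isSensitiveSwap
    fun J hJ => hno J (hJ.trans (le_max_left _ _))
  set W := G.biUnion fun g => insert g.1 (insert g.2.1 g.2.2) with hW
  have hWc : W.card ≤ w := by
    rw [hw, ← hGc]
    refine card_biUnion_le_card_mul _ _ _ fun g hg => ?_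
    rw [← (hG g hg).card]
    exact (card_insert_le _ _).trans (Nat.succ_le_succ (card_insert_le _ _))
  have hWV : W ⊆ V := biUnion_subset.2 fun g hg =>
    insert_subset (hG g hg).fst_mem (insert_subset (hG g hg).snd_mem (hG g hg).subset)
  obtain ⟨Z, hZ, hZc, hmono⟩ := hM (V \ W)
    (by rw [card_sdiff_of_subset hWV]; omega) W.powerset
    (by rw [card_powerset]; exact Nat.pow_le_pow_right (by norm_num) hWc)
    (fun T => k - T.card) (fun _ _ => Nat.sub_le _ _)
    (fun T U => multilinearEval c (T ∪ U) = 1)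
  have hWZ : Disjoint W Z := disjoint_sdiff.mono_right hZ
  have hZV : Z ⊆ V := hZ.trans sdiff_subset
  choose U hUZ hUc using fun T : Finset ℕ => exists_subset_card_eq ((Nat.sub_le k T.card).trans hZc)
  have hmem : ∀ T ⊆ W, T.card ≤ k → ∀ U ⊆ Z, U.card = k - T.card →
      T ∪ U ∈ V.powersetCard k := fun T hT hTk U hU hUc => by
    refine mem_powersetCard.2 ⟨union_subset (hT.trans hWV) (hU.trans hZV), ?_⟩
    rw [card_union_of_disjoint (hWZ.mono hT hU)]
    omega
  obtain ⟨c', hc', hval⟩ := exists_degreeLT_of_completion hc (k := k)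
    (F := fun T => multilinearEval c (T ∪ U T)) hWZ hZc fun T hT hTk U' hU' hU'c => by
      obtain ⟨a, ha⟩ := hmono T (mem_powerset.2 hT)
      have h1 := ha U' hU' hU'c
      have h2 := ha (U T) (hUZ T) (hUc T)
      have h3 := hbool _ (hmem T hT hTk U' hU' hU'c)
      have h4 := hbool _ (hmem T hT hTk (U T) (hUZ T) (hUc T))
      by_cases h : a
      · rw [h1.2 h, h2.2 h]
      · rw [h3.resolve_right fun h' => h (h1.1 h'), h4.resolve_right fun h' => h (h2.1 h')]
  obtain ⟨J, hJ, hJdep⟩ := hm₀ W c' hc' (boolean_of_boolean_ball hc' fun T hT hTd => by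
    rw [hval T hT (hTd.trans hdk)]
    exact hbool _ (hmem T hT (hTd.trans hdk) _ (hUZ T) (hUc T)))
  -- Sets of weight `k` need no completion, so the chosen swaps remain sensitive for `c'`.
  have htop : ∀ T ⊆ W, T.card = k → multilinearEval c' T = multilinearEval c T := by
    intro T hT hTk
    rw [hval T hT hTk.le]
    have := hUc T
    rw [hTk, Nat.sub_self, card_eq_zero] at this
    rw [this, union_empty]
  have hmeet : ∀ g ∈ G, ∃ u, u ∈ swapPair g ∧ u ∈ J := fun g hg => by
    rw [← not_disjoint_iff]
    intro hdis
    have hs := hG g hg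
    have hgW : insert g.1 (insert g.2.1 g.2.2) ⊆ W :=
      subset_biUnion_of_mem (fun g : ℕ × ℕ × Finset ℕ => insert g.1 (insert g.2.1 g.2.2)) hg
    have h1 : insert g.1 g.2.2 ⊆ W :=
      (insert_subset_insert _ (subset_insert _ _)).trans hgW
    have h2 : insert g.2.1 g.2.2 ⊆ W := (subset_insert _ _).trans hgW
    have hi : g.1 ∉ J := disjoint_left.1 hdis (by simp [swapPair])
    have hj : g.2.1 ∉ J := disjoint_left.1 hdis (by simp [swapPair])
    apply hs.ne
    rw [← htop _ h1 (by rw [card_insert_of_notMem hs.fst_notMem, hs.card]),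
      ← htop _ h2 (by rw [card_insert_of_notMem hs.snd_notMem, hs.card])]
    exact hJdep _ h1 _ h2
      (by rw [insert_inter_of_notMem hi, insert_inter_of_notMem hj])
  choose! u hu huJ using hmeet
  have := card_le_card_of_injOn u huJ fun a ha b hb hab => by
    by_contra hne
    exact disjoint_left.1 (hGd a ha b hb hne) (hu a ha) (hab ▸ hu b hb)
  omega

/-- Boolean functions of degree at most `d` on slices of weight `2 d ≤ k ≤ n / 2` depend on a
bounded number of coordinates. -/
theorem exists_dependsOnlyOn (d : ℕ) :
    ∃ m : ℕ, ∀ (V : Finset ℕ) (k : ℕ) (c : Finset ℕ → ℝ), 2 * d ≤ k → 2 * k ≤ V.card →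
      DegreeLT (d + 1) c →
      (∀ x ∈ V.powersetCard k, multilinearEval c x = 0 ∨ multilinearEval c x = 1) →
      ∃ J : Finset ℕ, J.card ≤ m ∧ DependsOnlyOn V k J (multilinearEval c) := by
  obtain ⟨C, m, h⟩ := exists_dependsOnlyOn_of_large (d + 1) 2
  choose! m' hm' using fun k (hk : 2 * d ≤ k) => exists_dependsOnlyOn_of_fixed hk
  refine ⟨m + ∑ k ∈ range C, m' k, fun V k c hdk hkV hc hbool => ?_⟩
  -- Only finitely many `k` lie below `C`; the sum dominates each of their bounds.
  rcases lt_or_ge k C with hk | hk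
  · obtain ⟨J, hJ, hdep⟩ := hm' k hdk V c hc hbool
    have := single_le_sum (f := m') (fun _ _ => Nat.zero_le _) (mem_range.2 hk)
    exact ⟨J, by omega, hdep⟩
  · obtain ⟨J, hJ, hdep⟩ := h V k c {0, 1} hk (by omega) hc card_le_two
      fun x hx => by simpa using hbool x hx
    exact ⟨J, by omega, hdep⟩

/-! ### Points of the slice as finite sets -/

theorem sum_toNat_eq_card {n : ℕ} (x : Fin n → Bool) :
    ∑ i, (x i).toNat = (univ.filter fun i => x i = true).card := by
  rw [card_filter]
  exact sum_congr rfl fun i _ => by cases x i <;> rfl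

/-- The point of the slice with the given set of coordinates equal to one. -/
def Slice.ofFinset {n k : ℕ} (s : Finset (Fin n)) (hs : s.card = k) : Slice n k :=
  ⟨fun i => decide (i ∈ s), by simp [sum_toNat_eq_card, hs]⟩

/-- The set of coordinates, as natural numbers, at which `x` is one. -/
def onesSet {n : ℕ} (x : Fin n → Bool) : Finset ℕ :=
  (univ.filter fun i => x i = true).map Fin.valEmbedding

theorem val_mem_onesSet {n : ℕ} {x : Fin n → Bool} {i : Fin n} :
    (i : ℕ) ∈ onesSet x ↔ x i = true := by
  simp only [onesSet, mem_map, mem_filter, mem_univ, true_and, Fin.valEmbedding_apply]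
  exact ⟨fun ⟨j, hj, hji⟩ => Fin.ext hji ▸ hj, fun h => ⟨i, h, rfl⟩⟩

theorem onesSet_subset_range {n : ℕ} (x : Fin n → Bool) : onesSet x ⊆ range n := by
  intro i hi
  obtain ⟨j, -, rfl⟩ := mem_map.1 hi
  exact mem_range.2 j.2

theorem onesSet_mem_powersetCard {n k : ℕ} (x : Slice n k) :
    onesSet x.1 ∈ (range n).powersetCard k :=
  mem_powersetCard.2 ⟨onesSet_subset_range _, by
    rw [onesSet, card_map, ← sum_toNat_eq_card, x.2]⟩

theorem exists_onesSet_eq {n k : ℕ} {s : Finset ℕ} (hs : s ∈ (range n).powersetCard k) :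
    ∃ x : Slice n k, onesSet x.1 = s := by
  rw [mem_powersetCard] at hs
  have hset : onesSet (fun i : Fin n => decide ((i : ℕ) ∈ s)) = s := by
    ext a
    constructor
    · intro ha
      obtain ⟨j, hj, rfl⟩ := mem_map.1 ha
      simpa using hj
    · intro ha
      have := val_mem_onesSet (x := fun i : Fin n => decide ((i : ℕ) ∈ s))
        (i := ⟨a, mem_range.1 (hs.1 ha)⟩)
      exact this.2 (by simpa using ha)
  refine ⟨⟨_, ?_⟩, hset⟩
  rw [sum_toNat_eq_card, ← card_map Fin.valEmbedding]
  exact (congrArg card hset).trans hs.2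

/-- On 0/1 points a monomial depends only on its support, whose size is at most its degree;
coefficients are grouped by support. -/
theorem HasDegree.exists_multilinearEval {n k d : ℕ} {f : Slice n k → ℝ} (hf : HasDegree d f) :
    ∃ c : Finset ℕ → ℝ, DegreeLT (d + 1) c ∧ ∀ x, f x = multilinearEval c (onesSet x.1) := by
  obtain ⟨P, hP, hfP⟩ := hf
  refine ⟨fun S => ∑ t ∈ P.support.filter fun t => t.support.map Fin.valEmbedding = S, P.coeff t,
    fun S hS => sum_eq_zero fun t ht => ?_, fun x => ?_⟩
  · exfalso
    obtain ⟨htP, rfl⟩ := mem_filter.1 ht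
    have h1 := (MvPolynomial.le_totalDegree htP).trans hP
    have h2 : t.support.card ≤ t.sum fun _ e => e := by
      rw [card_eq_sum_ones]
      exact sum_le_sum fun i hi => Nat.one_le_iff_ne_zero.2 (Finsupp.mem_support_iff.1 hi)
    rw [card_map] at hS
    omega
  · rw [hfP, MvPolynomial.eval_eq, multilinearEval, sum_fiberwise_eq_sum_filter, sum_filter]
    refine sum_congr rfl fun t _ => ?_
    split_ifs with h
    · rw [prod_eq_one, mul_one]
      intro i hi
      have := mem_powerset.1 h (mem_map_of_mem Fin.valEmbedding hi)
      rw [Fin.valEmbedding_apply, val_mem_onesSet] at this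
      simp [this]
    · obtain ⟨a, ha, hax⟩ := not_subset.1 fun h' => h (mem_powerset.2 h')
      obtain ⟨i, hi, rfl⟩ := mem_map.1 ha
      rw [Fin.valEmbedding_apply, val_mem_onesSet, Bool.not_eq_true] at hax
      rw [prod_eq_zero hi, mul_zero]
      simp [hax, Finsupp.mem_support_iff.1 hi]

theorem isJuntaOn_of_forall {n k : ℕ} {J : Finset (Fin n)} {f : Slice n k → ℝ}
    (h : ∀ x y : Slice n k, (∀ i ∈ J, x.1 i = y.1 i) → f x = f y) : IsJuntaOn J f := by
  classical
  -- Patterns on `J` that no point of the slice realises get the irrelevant value `0`.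
  refine ⟨fun b => if hb : ∃ x : Slice n k, (fun i : J => x.1 i) = b then f hb.choose else 0,
    fun x => ?_⟩
  have hb : ∃ y : Slice n k, (fun i : J => y.1 i) = fun i : J => x.1 i := ⟨x, rfl⟩
  refine Eq.trans ?_ (dif_pos hb).symm
  exact h _ _ fun i hi => (congrFun hb.choose_spec ⟨i, hi⟩).symm

/-- The upper bound: above the threshold, Boolean degree `d` functions are juntas. -/
theorem exists_forall_isJunta (d : ℕ) :
    ∃ m : ℕ, ∀ k : ℕ, 2 * d ≤ k → ∀ n : ℕ, 2 * k ≤ n →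
      ∀ f : Slice n k → ℝ, IsBoolean f → HasDegree d f → IsJunta m f := by
  obtain ⟨m, hm⟩ := exists_dependsOnlyOn d
  refine ⟨m, fun k hdk n hkn f hbool hdeg => ?_⟩
  obtain ⟨c, hc, hfc⟩ := hdeg.exists_multilinearEval
  obtain ⟨J, hJ, hdep⟩ := hm (range n) k c hdk (by simpa using hkn) hc fun s hs => by
    obtain ⟨x, rfl⟩ := exists_onesSet_eq hs
    simpa [hfc] using hbool x
  refine ⟨univ.filter fun i => (i : ℕ) ∈ J, ?_, isJuntaOn_of_forall fun x y hxy => ?_⟩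
  · rw [← card_map Fin.valEmbedding]
    refine (card_le_card fun a ha => ?_).trans hJ
    obtain ⟨i, hi, rfl⟩ := mem_map.1 ha
    exact (mem_filter.1 hi).2
  · rw [hfc, hfc]
    refine hdep _ (onesSet_mem_powersetCard x) _ (onesSet_mem_powersetCard y) ?_
    ext a
    rw [mem_inter, mem_inter]
    refine and_congr_left fun haJ => ?_
    by_cases han : a < n
    · have := hxy ⟨a, han⟩ (by simpa using haJ)
      rw [← Fin.val_mk han, val_mem_onesSet, val_mem_onesSet, this]
    · exact iff_of_false (fun h => han (mem_range.1 (onesSet_subset_range _ h)))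
        fun h => han (mem_range.1 (onesSet_subset_range _ h))

/-! ### The lower bound -/

/-- The number of blocks (rows of `a`) on which `x` is identically one. -/
def blockCount {n k N e : ℕ} (a : Fin N → Fin e → Fin n) (x : Slice n k) : ℝ :=
  ∑ i, ∏ j, ((x.1 (a i j)).toNat : ℝ)

theorem hasDegree_blockCount {n k N e : ℕ} (a : Fin N → Fin e → Fin n) :
    HasDegree e (blockCount (k := k) a) := by
  refine ⟨∑ i, ∏ j, MvPolynomial.X (a i j), ?_, fun x => by simp [blockCount]⟩
  refine MvPolynomial.totalDegree_finsetSum_le fun i _ => ?_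
  refine (MvPolynomial.totalDegree_finsetProd _ _).trans ?_
  simp [MvPolynomial.totalDegree_X]

theorem prod_toNat_eq_ite {n e : ℕ} (b : Fin e → Fin n) (x : Fin n → Bool)
    [Decidable (∀ j, x (b j) = true)] :
    ∏ j, ((x (b j)).toNat : ℝ) = if ∀ j, x (b j) = true then 1 else 0 := by
  split_ifs with h
  · simp [h]
  · push Not at h
    obtain ⟨j, hj⟩ := h
    exact prod_eq_zero (mem_univ j) (by simp [Bool.eq_false_of_not_eq_true hj])

/-- `Function.Injective2 a` says that the blocks are disjoint with distinct entries, so two full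
blocks would require `2 * e > k` ones. -/
theorem isBoolean_blockCount {n k N e : ℕ} {a : Fin N → Fin e → Fin n}
    (ha : Function.Injective2 a) (hk : k < 2 * e) : IsBoolean (blockCount (k := k) a) := by
  intro x
  simp only [blockCount, prod_toNat_eq_ite]
  by_cases h : ∃ i, ∀ j, x.1 (a i j) = true
  · obtain ⟨i, hi⟩ := h
    right
    rw [Set.mem_singleton_iff, sum_eq_single i, if_pos hi]
    · intro i' _ hne
      refine if_neg fun hi' => ?_
      have hsub : (({i, i'} : Finset (Fin N)) ×ˢ (univ : Finset (Fin e))).image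
          (fun p => a p.1 p.2) ⊆ univ.filter fun l => x.1 l = true := by
        intro l hl
        obtain ⟨⟨p, j⟩, hp, rfl⟩ := mem_image.1 hl
        rw [mem_product, mem_insert, mem_singleton] at hp
        rw [mem_filter]
        refine ⟨mem_univ _, ?_⟩
        change x.1 (a p j) = true
        rcases hp.1 with h | h
        · rw [show p = i from h, hi j]
        · rw [show p = i' from h, hi' j]
      have := card_le_card hsub
      rw [card_image_of_injective _ fun p q hpq => Prod.ext (ha hpq).1 (ha hpq).2, card_product,
        card_pair hne.symm, card_univ, Fintype.card_fin, ← sum_toNat_eq_card, x.2] at this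
      omega
    · simp
  · left
    push Not at h
    exact sum_eq_zero fun i _ => if_neg fun hi => (h i).elim fun j hj => hj (hi j)

/-- Some block misses `J`. A point filling it and a point supported on `E \ J` can agree on `J`,
both being zero there, while only the first has a full block. -/
theorem not_isJunta_blockCount {n k N e m : ℕ} {a : Fin N → Fin e → Fin n}
    (ha : Function.Injective2 a) (he : 0 < e) (hek : e ≤ k) (hm : m < N)
    {E : Finset (Fin n)} (hE : ∀ i j, a i j ∉ E) (hEc : m + k ≤ E.card) :
    ¬ IsJunta m (blockCount (k := k) a) := by
  rintro ⟨J, hJ, g, hg⟩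
  obtain ⟨i, hi⟩ : ∃ i, ∀ j, a i j ∉ J := by
    by_contra! h
    choose j hj using h
    have := card_le_card_of_injOn (s := univ) (fun i => a i (j i)) (fun i _ => hj i)
      fun i _ i' _ h => (ha h).1
    rw [card_univ, Fintype.card_fin] at this
    omega
  obtain ⟨R, hR, hRk⟩ : ∃ R ⊆ E \ J, R.card = k := by
    apply exists_subset_card_eq
    have := le_card_sdiff J E
    omega
  obtain ⟨R', hR', hR'k⟩ : ∃ R' ⊆ R, R'.card = k - e := exists_subset_card_eq (by omega)
  have hRE : R ⊆ E := hR.trans sdiff_subset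
  have hRJ : Disjoint R J := disjoint_sdiff.symm.mono_left hR
  have hdis : Disjoint (univ.image (a i)) R' := disjoint_left.2 fun l hl hlR => by
    obtain ⟨j, -, rfl⟩ := mem_image.1 hl
    exact hE i j (hRE (hR' hlR))
  let y : Slice n k := .ofFinset R hRk
  let x : Slice n k := .ofFinset (univ.image (a i) ∪ R') (by
    rw [card_union_of_disjoint hdis, card_image_of_injective _ fun j j' h => (ha h).2, card_univ,
      Fintype.card_fin]
    omega)
  have hy : blockCount a y = 0 := sum_eq_zero fun i' _ =>
    prod_eq_zero (mem_univ ⟨0, he⟩) (by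
      have : a i' ⟨0, he⟩ ∉ R := fun h => hE i' ⟨0, he⟩ (hRE h)
      simp [y, Slice.ofFinset, this])
  have hx : 0 < blockCount a x := by
    refine sum_pos' (fun _ _ => prod_nonneg fun _ _ => Nat.cast_nonneg _) ⟨i, mem_univ _, ?_⟩
    exact prod_pos fun j _ => by simp [x, Slice.ofFinset]
  have hxy : blockCount a x = blockCount a y := by
    rw [hg, hg]
    congr 1
    funext l
    have h1 : l.1 ∉ R := fun h => disjoint_left.1 hRJ h l.2
    have h2 : l.1 ∉ R' := fun h => h1 (hR' h)
    have h3 : ∀ j, a i j ≠ l.1 := fun j h => hi j (h ▸ l.2)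
    simp [x, y, Slice.ofFinset, h1, h2, h3]
  rw [hxy, hy] at hx
  exact lt_irrefl _ hx

/-- The lower bound: below the threshold there are Boolean degree `d` functions which depend on
arbitrarily many coordinates. -/
theorem exists_not_isJunta {d k : ℕ} (hd : 1 ≤ d) (hk : 1 ≤ k) (hkd : k < 2 * d) (m : ℕ) :
    ∃ n : ℕ, 2 * k ≤ n ∧ ∃ f : Slice n k → ℝ, IsBoolean f ∧ HasDegree d f ∧ ¬ IsJunta m f := by
  -- `e ≤ d` bounds the degree, `e ≤ k` lets a block be full, and `k < 2 * e` holds in either case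
  -- of the minimum.
  set e := min d k with he
  let a : Fin (m + 1) → Fin e → Fin ((m + 1) * e + (m + 2 * k)) := fun i j =>
    Fin.castAdd _ (finProdFinEquiv (i, j))
  have ha : Function.Injective2 a := fun i i' j j' h => by
    have := finProdFinEquiv.injective (Fin.castAdd_injective _ _ h)
    exact Prod.mk.inj this
  refine ⟨_, by omega, blockCount a, isBoolean_blockCount ha (by omega), ?_,
    not_isJunta_blockCount ha (by omega) (by omega) (Nat.lt_succ_self m)
      (E := univ.map (Fin.natAddEmb ((m + 1) * e))) ?_ ?_⟩
  · obtain ⟨P, hP, h⟩ := hasDegree_blockCount (k := k) a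
    exact ⟨P, hP.trans (min_le_left _ _), h⟩
  · intro i j h
    obtain ⟨t, -, ht⟩ := mem_map.1 h
    have := congrArg Fin.val ht
    have h2 := (finProdFinEquiv (i, j)).2
    simp only [a, Fin.natAddEmb_apply, Fin.val_natAdd, Fin.val_castAdd] at this
    omega
  · rw [card_map, card_univ, Fintype.card_fin]
    omega

end BooleanSlice

theorem theorem1p1 (d : ℕ) (hd : 1 ≤ d) :
    (∃ m : ℕ, ∀ k : ℕ, 2 * d ≤ k → ∀ n : ℕ, 2 * k ≤ n →
      ∀ f : BooleanSlice.Slice n k → ℝ,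
        BooleanSlice.IsBoolean f → BooleanSlice.HasDegree d f → BooleanSlice.IsJunta m f) ∧
    (∀ k : ℕ, 1 ≤ k → k < 2 * d → ∀ m : ℕ, ∃ n : ℕ, 2 * k ≤ n ∧
      ∃ f : BooleanSlice.Slice n k → ℝ,
        BooleanSlice.IsBoolean f ∧ BooleanSlice.HasDegree d f ∧ ¬ BooleanSlice.IsJunta m f) := by
  exact ⟨BooleanSlice.exists_forall_isJunta d,
    fun _ hk hkd => BooleanSlice.exists_not_isJunta hd hk hkd⟩
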